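/- **Setting.** Let $\Omega$ be a finite non-empty outcome space and $\rho:\Omega\to\mathbb{R}^K$ a payoff function, with price space $\mathcal{M}=\operatorname{conv}\{\rho(\omega):\omega\in\Omega\}$. A function $C:\mathbb{R}^n\to\mathbb{R}$ is an *arbitrage-free bounded-loss cost function* for a payoff function with price space $\mathcal{N}\subseteq\mathbb{R}^n$ if it is convex and its conjugate $R(\mu)=\sup_q[\mu\cdot q-C(q)]$ is finite exactly for $\mu\in\mathcal{N}$. The $K$ securities are partitioned into finitely many submarkets $g\in\mathcal{G}$; $q_g$ denotes the block of coordinates of $q$ in $g$. For each $g$ let $C_g:\mathbb{R}^g\to\mathbb{R}$ be an arbitrage-free bounded-loss cost function for $\rho_g$. Let $A\in\mathbb{R}^{K\times M}$ and $b\in\mathbb{R}^M$ be such that $\mathcal{M}=\{\mu\in\mathbb{R}^K: A^\top\mu\ge b\}$, and for each $g$ let $\beta_g:\mathbb{R}\to(0,\infty)$ be a differentiable non-increasing function (the information-utility schedule). **Gradual decrease LCMM.** Its time-sensitive cost function is $$\mathbf{C}(q;t)=\inf_{\eta\in\mathbb{R}^M,\ \eta\ge 0}\Bigl[\sum_{g\in\mathcal{G}}\beta_g(t)\,C_g\!\Bigl(\frac{(q+A\eta)_g}{\beta_g(t)}\Bigr)-b\cdot\eta\Bigr].$$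 Its state update is any function $\mathtt{NewState}(s;t,t')$ such that for all $s\in\mathbb{R}^K$ and $t\le t'$ there is a minimizer $\eta^\star$ in the definition of $\mathbf{C}(s;t)$ such that, with $\delta^\star=A\eta^\star$ and $\alpha_g=\beta_g(t')/\beta_g(t)$, for every $g$, $$\mathtt{NewState}(s;t,t')_g=\alpha_g s_g+(\alpha_g-1)\,\delta^\star_g .$$ **Worst-case loss.** For a cost function $C$ and an initial state $s$, $$\mathtt{WCLoss}(C;s)=\sup_{\omega\in\Omega,\ r\in\mathbb{R}^K}\bigl[\rho(\omega)\cdot r-C(s+r)+C(s)\bigr].$$ For the gradual decrease market maker with initial state $s^0$ and initial time $t^0$, $$\mathtt{WCLoss}(\mathbf{C},\mathtt{NewState};s^0,t^0)=\sup\sum_{i=1}^N\bigl[\rho(\omega)\cdot r^i-\mathbf{C}(\tilde s^{\,i-1}+r^i;t^i)+\mathbf{C}(\tilde s^{\,i-1};t^i)\bigr],$$ where $\tilde s^{\,i-1}=\mathtt{NewState}(s^{i-1};t^{i-1},t^i)$ and $s^i=\tilde s^{\,i-1}+r^i$, and the supremum is over $\omega\in\Omega$, $N\ge 0$, bundles $r^1,\dots,r^N\in\mathbb{R}^K$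 and times $t^0\le t^1\le\dots\le t^N$. **Theorem.** A minimizer $\eta^\star$ exists for every state and time, so an update function $\mathtt{NewState}$ of the gradual decrease LCMM exists; and for every such $\mathtt{NewState}$, every initial state $s^0\in\mathbb{R}^K$ and every initial time $t^0\in\mathbb{R}$, $$\mathtt{WCLoss}(\mathbf{C},\mathtt{NewState};s^0,t^0)\le\mathtt{WCLoss}(C^0;s^0),\qquad\text{where } C^0=\mathbf{C}(\cdot\,;t^0).$$ -/

import Mathlib

open scoped Matrix

noncomputable section

namespace GradualMarket

/-- The price space: the convex hull of the payoff vectors `ρ ω`. -/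
def priceSpace {Ω κ : Type*} (ρ : Ω → κ → ℝ) : Set (κ → ℝ) :=
  convexHull ℝ (Set.range ρ)

/-- The convex conjugate `R μ = sup_q (μ · q - C q)`, with values in the extended reals. -/
def conjugate {κ : Type*} [Fintype κ] (C : (κ → ℝ) → ℝ) (μ : κ → ℝ) : EReal :=
  ⨆ q : κ → ℝ, ((μ ⬝ᵥ q - C q : ℝ) : EReal)

/-- The points at which the conjugate of `C` is finite (it never takes the value `-∞`). -/
def conjugateDomain {κ : Type*} [Fintype κ] (C : (κ → ℝ) → ℝ) : Set (κ → ℝ) :=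
  {μ | conjugate C μ < ⊤}

/-- Arbitrage-free bounded-loss cost functions for the payoff `ρ`: convex functions whose
conjugate is finite exactly on the price space. -/
structure IsCostFunction {Ω κ : Type*} [Fintype κ] (ρ : Ω → κ → ℝ) (C : (κ → ℝ) → ℝ) :
    Prop where
  convex : ConvexOn ℝ Set.univ C
  conjugateDomain_eq : conjugateDomain C = priceSpace ρ

section LCMM

variable {K M : ℕ} {G : Type*}

/-- The block of coordinates of `q` which belong to the submarket `g`. -/
def block (sub : Fin K → G) (g : G) (q : Fin K → ℝ) : {i : Fin K // sub i = g} → ℝ :=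
  fun i => q i

variable [Fintype G] [DecidableEq G]

/-- The direct-sum cost at time `t`: the submarket `g` uses the rescaled cost
`β g t * C g (q_g / β g t)`. -/
def directSumCost (sub : Fin K → G) (C : (g : G) → ({i : Fin K // sub i = g} → ℝ) → ℝ)
    (β : G → ℝ → ℝ) (q : Fin K → ℝ) (t : ℝ) : ℝ :=
  ∑ g : G, β g t * C g ((β g t)⁻¹ • block sub g q)

/-- The objective minimized by the arbitrager over bundle weights `η ≥ 0`. -/
def arbitrageObjective (sub : Fin K → G)
    (C : (g : G) → ({i : Fin K // sub i = g} → ℝ) → ℝ)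
    (A : Matrix (Fin K) (Fin M) ℝ) (b : Fin M → ℝ) (β : G → ℝ → ℝ)
    (q : Fin K → ℝ) (t : ℝ) (η : Fin M → ℝ) : ℝ :=
  directSumCost sub C β (q + A *ᵥ η) t - b ⬝ᵥ η

/-- The time-sensitive LCMM cost function. -/
def lcmmCost (sub : Fin K → G) (C : (g : G) → ({i : Fin K // sub i = g} → ℝ) → ℝ)
    (A : Matrix (Fin K) (Fin M) ℝ) (b : Fin M → ℝ) (β : G → ℝ → ℝ)
    (q : Fin K → ℝ) (t : ℝ) : ℝ :=
  ⨅ η : {η : Fin M → ℝ // 0 ≤ η}, arbitrageObjective sub C A b β q t η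

/-- `η` is an optimal arbitrage bundle in the state `q` at time `t`. -/
def IsOptimalArbitrage (sub : Fin K → G)
    (C : (g : G) → ({i : Fin K // sub i = g} → ℝ) → ℝ)
    (A : Matrix (Fin K) (Fin M) ℝ) (b : Fin M → ℝ) (β : G → ℝ → ℝ)
    (q : Fin K → ℝ) (t : ℝ) (η : Fin M → ℝ) : Prop :=
  0 ≤ η ∧ IsMinOn (arbitrageObjective sub C A b β q t) {η | 0 ≤ η} η

/-- `U s t t'` is a state update of the gradual decrease LCMM: with `α_g = β g t' / β g t` and
`δ = A η` for some optimal arbitrage bundle `η` in the state `s` at time `t`, the block `g` of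
the new state is `α_g s_g + (α_g - 1) δ_g`. Any choice of optimal bundles is allowed. -/
def IsNewState (sub : Fin K → G) (C : (g : G) → ({i : Fin K // sub i = g} → ℝ) → ℝ)
    (A : Matrix (Fin K) (Fin M) ℝ) (b : Fin M → ℝ) (β : G → ℝ → ℝ)
    (U : (Fin K → ℝ) → ℝ → ℝ → (Fin K → ℝ)) : Prop :=
  ∀ (s : Fin K → ℝ) (t t' : ℝ), t ≤ t' →
    ∃ η : Fin M → ℝ, IsOptimalArbitrage sub C A b β s t η ∧
      ∀ i : Fin K, U s t t' i =
        β (sub i) t' / β (sub i) t * s i + (β (sub i) t' / β (sub i) t - 1) * (A *ᵥ η) i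

end LCMM

section Loss

variable {Ω : Type*} {K : ℕ}

/-- Worst-case loss of a market maker using the fixed cost function `C`. -/
def wcLoss (ρ : Ω → Fin K → ℝ) (C : (Fin K → ℝ) → ℝ) (s : Fin K → ℝ) : EReal :=
  ⨆ (ω : Ω) (r : Fin K → ℝ), ((ρ ω ⬝ᵥ r - C (s + r) + C s : ℝ) : EReal)

/-- The state `s^i` after `i` trades, where the trade `i` (for `i ≥ 1`) is of the bundle `r i`
at time `t i`. -/
def stateAfter (U : (Fin K → ℝ) → ℝ → ℝ → (Fin K → ℝ)) (s₀ : Fin K → ℝ)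
    (r : ℕ → Fin K → ℝ) (t : ℕ → ℝ) : ℕ → Fin K → ℝ
  | 0 => s₀
  | i + 1 => U (stateAfter U s₀ r t i) (t i) (t (i + 1)) + r (i + 1)

/-- The updated state in which the trade `i + 1` is priced. -/
def updatedState (U : (Fin K → ℝ) → ℝ → ℝ → (Fin K → ℝ)) (s₀ : Fin K → ℝ)
    (r : ℕ → Fin K → ℝ) (t : ℕ → ℝ) (i : ℕ) : Fin K → ℝ :=
  U (stateAfter U s₀ r t i) (t i) (t (i + 1))

/-- Loss of the gradual decrease market maker after the trades `1, …, N`, if the security payoffs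
turn out to be `x`. -/
def gradualLoss (C : (Fin K → ℝ) → ℝ → ℝ) (U : (Fin K → ℝ) → ℝ → ℝ → (Fin K → ℝ))
    (s₀ : Fin K → ℝ) (x : Fin K → ℝ) (N : ℕ) (r : ℕ → Fin K → ℝ) (t : ℕ → ℝ) : ℝ :=
  ∑ i ∈ Finset.range N,
    (x ⬝ᵥ r (i + 1)
      - C (updatedState U s₀ r t i + r (i + 1)) (t (i + 1))
      + C (updatedState U s₀ r t i) (t (i + 1)))

/-- Worst-case loss of the gradual decrease market maker with time-sensitive cost `C` and state
update `U`: the supremum over outcomes, numbers of trades `N`, and trades at times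
`t₀ = t 0 ≤ t 1 ≤ … ≤ t N`. Entries of `r` and `t` beyond `N` play no role. -/
def gradualWCLoss (ρ : Ω → Fin K → ℝ) (C : (Fin K → ℝ) → ℝ → ℝ)
    (U : (Fin K → ℝ) → ℝ → ℝ → (Fin K → ℝ)) (s₀ : Fin K → ℝ) (t₀ : ℝ) : EReal :=
  ⨆ (ω : Ω) (N : ℕ) (r : ℕ → Fin K → ℝ) (t : ℕ → ℝ)
    (_ : t 0 = t₀ ∧ ∀ i < N, t i ≤ t (i + 1)),
    ((gradualLoss C U s₀ (ρ ω) N r t : ℝ) : EReal)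

end Loss

end GradualMarket

end

open Filter Topology

namespace GradualMarket

/-! Fix an outcome with payoff `x`, and let `R g` be the conjugate of `C g` at its block. The
potential is the Fenchel gap `∑ g, β g t * R g + lcmmCost s t - x ⬝ᵥ s`, which is nonnegative. A
trade lowers it by exactly the market maker's loss. An update does not raise it
(`fenchelGap_update_le`): the update keeps every scaled position `(s + A η)_g / β_g` fixed, so the
gap is bounded by a `β`-weighted sum of nonnegative submarket gaps plus an unchanged term, and the
weights decrease. Hence the total loss is at most the initial gap, which a single trade at time `t₀`
approaches (`fenchelGap_le_wcLoss`).

Optimal bundles exist although sublevel sets may be unbounded: a nonnegative recession direction of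
the objective has constant payoff in each submarket, so it can be subtracted at no cost. -/

/-! ### Attainment of minima on the orthant -/

/-- A convex function that is bounded below on the nonnegative orthant attains its minimum there,
provided it does not increase backwards along its nonnegative directions of recession. -/
theorem exists_isMinOn_nonneg {ι : Type*} [Fintype ι] {f : (ι → ℝ) → ℝ}
    (hf : ConvexOn ℝ Set.univ f) (hbdd : BddBelow (f '' {η | 0 ≤ η}))
    (hrec : ∀ d, 0 ≤ d → (∀ η, ∀ s : ℝ, 0 ≤ s → f (η + s • d) ≤ f η) → ∀ η, f (η - d) ≤ f η) :
    ∃ η, 0 ≤ η ∧ IsMinOn f {η | 0 ≤ η} η := by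
  have hfc : Continuous f := hf.locallyLipschitz.continuous
  have hSc : Continuous fun η : ι → ℝ => ∑ i, η i := by fun_prop
  obtain ⟨c, hc_anti, hc_lim, hc_mem⟩ :=
    exists_seq_tendsto_sInf (S := f '' {η | 0 ≤ η}) ⟨f 0, 0, Set.mem_ofPred_eq.mpr le_rfl, rfl⟩ hbdd
  have hle_sum : ∀ {η : ι → ℝ}, 0 ≤ η → ∀ i, η i ≤ ∑ j, η j := fun hη i =>
    Finset.single_le_sum (f := _) (fun j _ => hη j) (Finset.mem_univ i)
  -- minimize the sum of the coordinates on every sublevel set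
  have key : ∀ n, ∃ η : ι → ℝ, 0 ≤ η ∧ f η ≤ c n ∧
      ∀ ξ : ι → ℝ, 0 ≤ ξ → f ξ ≤ c n → ∑ i, η i ≤ ∑ i, ξ i := by
    intro n
    obtain ⟨η₀, hη₀, hfη₀⟩ := hc_mem n
    have hη₀' : 0 ≤ η₀ := hη₀
    have hcomp : IsCompact (Set.Icc (0 : ι → ℝ) (fun _ => ∑ i, η₀ i) ∩ {η | f η ≤ c n}) :=
      isCompact_Icc.inter_right (isClosed_le hfc continuous_const)
    obtain ⟨η, ⟨⟨hη0, -⟩, hηc⟩, hmin⟩ := hcomp.exists_isMinOn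
      ⟨η₀, ⟨hη₀', fun i => hle_sum hη₀' i⟩, hfη₀.le⟩ hSc.continuousOn
    refine ⟨η, hη0, hηc, fun ξ hξ hξc => ?_⟩
    by_cases h : ∑ i, ξ i ≤ ∑ i, η₀ i
    · exact hmin ⟨⟨hξ, fun i => (hle_sum hξ i).trans h⟩, hξc⟩
    · exact (hmin ⟨⟨hη₀', fun i => hle_sum hη₀' i⟩, hfη₀.le⟩).trans (not_le.1 h).le
  choose η hη0 hηc hηmin using key
  by_cases hT : Tendsto (fun n => ∑ i, η n i) atTop atTop
  -- If the minimal sums diverge, the normalized minimizers accumulate at a recession direction `d`;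
  -- subtracting `d` lowers the sum within the same sublevel set.
  · exfalso
    have hmem : ∀ n, (∑ i, η n i)⁻¹ • η n ∈ Set.Icc (0 : ι → ℝ) 1 := by
      intro n
      have hS : 0 ≤ ∑ i, η n i := Finset.sum_nonneg fun i _ => hη0 n i
      refine ⟨smul_nonneg (inv_nonneg.2 hS) (hη0 n), fun i => ?_⟩
      simp only [Pi.smul_apply, smul_eq_mul, Pi.one_apply]
      exact inv_mul_le_one_of_le₀ (hle_sum (hη0 n) i) hS
    obtain ⟨d, ⟨hd0, -⟩, φ, hφ, hlim⟩ := isCompact_Icc.tendsto_subseq hmem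
    have hT' : Tendsto (fun n => ∑ i, η (φ n) i) atTop atTop := hT.comp hφ.tendsto_atTop
    have hinv : Tendsto (fun n => (∑ i, η (φ n) i)⁻¹) atTop (𝓝 0) := tendsto_inv_atTop_zero.comp hT'
    have hSd : ∑ i, d i = 1 := by
      refine tendsto_nhds_unique ((hSc.tendsto d).comp hlim) (tendsto_const_nhds.congr' ?_)
      filter_upwards [hT'.eventually_gt_atTop 0] with n hn
      simp only [Function.comp_apply, Pi.smul_apply, smul_eq_mul, ← Finset.mul_sum]
      exact (inv_mul_cancel₀ hn.ne').symm
    have hback := hrec d hd0 fun ξ s hs => by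
      -- Convex combinations of `ξ` and `η (φ n)` with weight `s / ∑ η` tend to `ξ + s • d`, while
      -- the convexity bounds tend to `f ξ`.
      have h1 : Tendsto (fun n => (1 - s * (∑ i, η (φ n) i)⁻¹) • ξ
          + s • ((∑ i, η (φ n) i)⁻¹ • η (φ n))) atTop (𝓝 ((1 - s * 0) • ξ + s • d)) :=
        ((tendsto_const_nhds.sub (hinv.const_mul s)).smul_const ξ).add (hlim.const_smul s)
      have h2 : Tendsto (fun n => (1 - s * (∑ i, η (φ n) i)⁻¹) * f ξ
          + s * (∑ i, η (φ n) i)⁻¹ * c 0) atTop (𝓝 ((1 - s * 0) * f ξ + s * 0 * c 0)) :=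
        ((tendsto_const_nhds.sub (hinv.const_mul s)).mul_const _).add
          ((hinv.const_mul s).mul_const _)
      have h3 := le_of_tendsto_of_tendsto ((hfc.tendsto _).comp h1) h2 (by
        filter_upwards [hT'.eventually_gt_atTop 0, hT'.eventually_ge_atTop s] with n hn hns
        have hle : s * (∑ i, η (φ n) i)⁻¹ ≤ 1 := by
          rw [← div_eq_mul_inv]; exact (div_le_one hn).2 hns
        have h0 : 0 ≤ s * (∑ i, η (φ n) i)⁻¹ := mul_nonneg hs (inv_nonneg.2 hn.le)
        have := hf.2 (Set.mem_univ ξ) (Set.mem_univ (η (φ n))) (sub_nonneg.2 hle) h0 (by ring)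
        simp only [smul_eq_mul] at this
        simp only [Function.comp_apply, smul_smul]
        exact this.trans (add_le_add le_rfl (mul_le_mul_of_nonneg_left
          ((hηc _).trans (hc_anti (Nat.zero_le _))) h0)))
      simpa using h3
    have hev : ∀ᶠ n in atTop, ∀ i, d i ≤ η (φ n) i := by
      refine eventually_all.2 fun i => ?_
      rcases (hd0 i).eq_or_lt with h | h
      · exact Eventually.of_forall fun n => h ▸ hη0 _ i
      · have hi : Tendsto (fun n => (∑ j, η (φ n) j)⁻¹ * η (φ n) i) atTop (𝓝 (d i)) :=
          (tendsto_pi_nhds.1 hlim) i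
        filter_upwards [hi.eventually_const_lt (half_lt_self h),
          hT'.eventually_ge_atTop 2] with n hn h2
        have hpos : 0 < ∑ j, η (φ n) j := by linarith
        have := (lt_inv_mul_iff₀ hpos).1 hn
        have hdi : (0 : ℝ) < d i := h
        nlinarith
    obtain ⟨n, hn⟩ := hev.exists
    have := hηmin (φ n) (η (φ n) - d) (fun i => sub_nonneg.2 (hn i))
      ((hback _).trans (hηc _))
    simp only [Pi.sub_apply, Finset.sum_sub_distrib, hSd] at this
    linarith
  -- Otherwise the sums stay below some `B` infinitely often, and a cluster point is a minimizer.
  · simp only [tendsto_atTop, not_forall, not_eventually, not_le] at hT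
    obtain ⟨B, hB⟩ := hT
    obtain ⟨ξ, ⟨hξ0, -⟩, φ, hφ, hlim⟩ :=
      (isCompact_Icc (a := (0 : ι → ℝ)) (b := fun _ => B)).tendsto_subseq'
        (hB.mono fun n hn => ⟨hη0 n, fun i => (hle_sum (hη0 n) i).trans hn.le⟩)
    refine ⟨ξ, hξ0, fun ζ hζ => ?_⟩
    have : f ξ ≤ sInf (f '' {η | 0 ≤ η}) :=
      le_of_tendsto_of_tendsto' ((hfc.tendsto ξ).comp hlim) (hc_lim.comp hφ.tendsto_atTop)
        fun n => hηc _
    exact this.trans (csInf_le hbdd ⟨ζ, hζ, rfl⟩)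

/-! ### Conjugates and translation equivariance -/

section CostFunction

variable {Ω κ : Type*} [Fintype κ] {ρ : Ω → κ → ℝ} {C : (κ → ℝ) → ℝ}

theorem mem_conjugateDomain_of_forall_le {μ : κ → ℝ} {c : ℝ} (h : ∀ q, μ ⬝ᵥ q - C q ≤ c) :
    μ ∈ conjugateDomain C :=
  (iSup_le fun q => EReal.coe_le_coe_iff.2 (h q)).trans_lt (EReal.coe_lt_top c)

/-- At every payoff vector the conjugate of a cost function is a real number. -/
theorem IsCostFunction.exists_isLUB (h : IsCostFunction ρ C) (ω : Ω) :
    ∃ R : ℝ, IsLUB (Set.range fun q => ρ ω ⬝ᵥ q - C q) R := by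
  have hω : ρ ω ∈ conjugateDomain C :=
    h.conjugateDomain_eq ▸ subset_convexHull ℝ _ (Set.mem_range_self ω)
  obtain ⟨c, hc, -⟩ := EReal.lt_iff_exists_real_btwn.1 (show conjugate C (ρ ω) < ⊤ from hω)
  refine ⟨_, isLUB_csSup (Set.range_nonempty _) ⟨c, ?_⟩⟩
  rintro _ ⟨q, rfl⟩
  exact EReal.coe_le_coe_iff.1 ((le_iSup (fun q => ((ρ ω ⬝ᵥ q - C q : ℝ) : EReal)) q).trans hc.le)

/-- A cost function dominates its translate along a bundle of constant payoff. -/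
theorem IsCostFunction.add_le (h : IsCostFunction ρ C) {v : κ → ℝ} {k : ℝ}
    (hv : ∀ ω, ρ ω ⬝ᵥ v = k) (x : κ → ℝ) : C x + k ≤ C (x + v) := by
  classical
  refine le_of_forall_lt fun a ha => ?_
  obtain ⟨a', ha', ha'C⟩ := exists_between (sub_lt_iff_lt_add.2 ha)
  -- An affine minorant almost touching `C` at `x` has a slope with finite conjugate, hence in the
  -- price space, where pairing with `v` gives `k`.
  obtain ⟨l, c, hl, hlx⟩ := h.convex.exists_affine_le_of_lt (𝕜 := ℝ) (Set.mem_univ x) ha'C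
    isClosed_univ
    (h.convex.locallyLipschitz.continuous.lowerSemicontinuous.lowerSemicontinuousOn _)
  have hle : ∀ q, l q + c ≤ C q := fun q => by simpa using hl ⟨q, Set.mem_univ q⟩
  set μ : κ → ℝ := (dotProductEquiv ℝ κ).symm l.toLinearMap with hμ
  have hμl : ∀ q, μ ⬝ᵥ q = l q := fun q => by
    rw [← dotProductEquiv_apply_apply, hμ, LinearEquiv.apply_symm_apply]; rfl
  have hmem : μ ∈ priceSpace ρ := h.conjugateDomain_eq ▸
    mem_conjugateDomain_of_forall_le (c := -c) fun q => by rw [hμl]; linarith [hle q]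
  have hlin : priceSpace ρ ⊆ {ν | ν ⬝ᵥ v = k} :=
    convexHull_min (by rintro _ ⟨ω, rfl⟩; exact hv ω) fun y hy z hz a b _ _ hab => by
      simp only [Set.mem_ofPred_eq] at hy hz ⊢
      rw [add_dotProduct, smul_dotProduct, smul_dotProduct, hy, hz, ← add_smul, hab, one_smul]
  have h1 : l v = k := (hμl v).symm.trans (hlin hmem)
  have h2 := hle (x + v)
  rw [map_add] at h2
  simp only [RCLike.re_to_real] at hlx
  linarith

/-- Cost functions are translation equivariant along bundles of constant payoff. -/
theorem IsCostFunction.apply_add (h : IsCostFunction ρ C) {v : κ → ℝ} {k : ℝ}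
    (hv : ∀ ω, ρ ω ⬝ᵥ v = k) (x : κ → ℝ) : C (x + v) = C x + k := by
  refine le_antisymm ?_ (h.add_le hv x)
  have := h.add_le (v := -v) (k := -k) (fun ω => by rw [dotProduct_neg, hv]) (x + v)
  rw [add_neg_cancel_right] at this
  linarith

end CostFunction

/-! ### The arbitrage objective and its minimizers -/

section LCMM

variable {Ω G : Type*} {K M : ℕ} {ρ : Ω → Fin K → ℝ}
  {sub : Fin K → G} {C : (g : G) → ({i : Fin K // sub i = g} → ℝ) → ℝ}
  {A : Matrix (Fin K) (Fin M) ℝ} {b : Fin M → ℝ} {β : G → ℝ → ℝ}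

theorem block_add (g : G) (x y : Fin K → ℝ) :
    block sub g (x + y) = block sub g x + block sub g y := rfl

theorem block_smul (g : G) (a : ℝ) (x : Fin K → ℝ) :
    block sub g (a • x) = a • block sub g x := rfl

variable [Fintype G]

theorem lcmmCost_le_arbitrageObjective {q : Fin K → ℝ} {t : ℝ}
    (hbdd : BddBelow (arbitrageObjective sub C A b β q t '' {η | 0 ≤ η}))
    {η : Fin M → ℝ} (hη : 0 ≤ η) :
    lcmmCost sub C A b β q t ≤ arbitrageObjective sub C A b β q t η := by
  rw [Set.image_eq_range] at hbdd
  exact ciInf_le hbdd ⟨η, hη⟩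

theorem IsOptimalArbitrage.lcmmCost_eq {q : Fin K → ℝ} {t : ℝ} {η : Fin M → ℝ}
    (h : IsOptimalArbitrage sub C A b β q t η) :
    lcmmCost sub C A b β q t = arbitrageObjective sub C A b β q t η := by
  have : Nonempty {η : Fin M → ℝ // 0 ≤ η} := ⟨⟨η, h.1⟩⟩
  refine le_antisymm (lcmmCost_le_arbitrageObjective ⟨arbitrageObjective sub C A b β q t η, ?_⟩ h.1)
    (le_ciInf fun ξ => h.2 ξ.2)
  rintro _ ⟨ξ, hξ, rfl⟩
  exact h.2 hξ

theorem convexOn_arbitrageObjective (hC : ∀ g, ConvexOn ℝ Set.univ (C g))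
    (hβ : ∀ g t, 0 < β g t) (q : Fin K → ℝ) (t : ℝ) :
    ConvexOn ℝ Set.univ (arbitrageObjective sub C A b β q t) := by
  refine ⟨convex_univ, fun x _ y _ u v hu hv huv => ?_⟩
  have hblock : ∀ g, (β g t)⁻¹ • block sub g (q + A *ᵥ (u • x + v • y)) =
      u • (β g t)⁻¹ • block sub g (q + A *ᵥ x) + v • (β g t)⁻¹ • block sub g (q + A *ᵥ y) := by
    intro g
    rw [smul_comm u, smul_comm v, ← smul_add, ← block_smul (a := u), ← block_smul (a := v),
      ← block_add]
    congr 2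
    rw [Matrix.mulVec_add, Matrix.mulVec_smul, Matrix.mulVec_smul, smul_add, smul_add,
      add_add_add_comm, ← add_smul, huv, one_smul]
  have hg : ∀ g, β g t * C g ((β g t)⁻¹ • block sub g (q + A *ᵥ (u • x + v • y))) ≤
      u * (β g t * C g ((β g t)⁻¹ • block sub g (q + A *ᵥ x)))
        + v * (β g t * C g ((β g t)⁻¹ • block sub g (q + A *ᵥ y))) := by
    intro g
    have := mul_le_mul_of_nonneg_left
      ((hC g).2 (Set.mem_univ ((β g t)⁻¹ • block sub g (q + A *ᵥ x)))
        (Set.mem_univ ((β g t)⁻¹ • block sub g (q + A *ᵥ y))) hu hv huv) (hβ g t).le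
    rw [hblock]
    simp only [smul_eq_mul] at this
    linarith
  have := Finset.sum_le_sum fun g (_ : g ∈ Finset.univ) => hg g
  rw [Finset.sum_add_distrib, ← Finset.mul_sum, ← Finset.mul_sum] at this
  simp only [arbitrageObjective, directSumCost, dotProduct_add, dotProduct_smul, smul_eq_mul]
  linarith

variable [DecidableEq G]

theorem sum_block_dotProduct (x q : Fin K → ℝ) :
    ∑ g, block sub g x ⬝ᵥ block sub g q = x ⬝ᵥ q :=
  Fintype.sum_fiberwise sub fun i => x i * q i

/-- Fenchel's inequality for the direct-sum cost. -/
theorem dotProduct_sub_le_directSumCost {x : (g : G) → {i : Fin K // sub i = g} → ℝ} {R : G → ℝ}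
    (hβ : ∀ g t, 0 < β g t) (hR : ∀ g p, x g ⬝ᵥ p - C g p ≤ R g) (q : Fin K → ℝ) (t : ℝ) :
    ∑ g, x g ⬝ᵥ block sub g q - ∑ g, β g t * R g ≤ directSumCost sub C β q t := by
  rw [← Finset.sum_sub_distrib]
  refine Finset.sum_le_sum fun g _ => ?_
  have := mul_le_mul_of_nonneg_left (hR g ((β g t)⁻¹ • block sub g q)) (hβ g t).le
  rw [dotProduct_smul, smul_eq_mul, mul_sub, mul_inv_cancel_left₀ (hβ g t).ne'] at this
  linarith

/-- Fenchel's inequality for the arbitrage objective, at a coherent price vector. -/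
theorem dotProduct_sub_le_arbitrageObjective {x : Fin K → ℝ} {R : G → ℝ}
    (hβ : ∀ g t, 0 < β g t) (hR : ∀ g p, block sub g x ⬝ᵥ p - C g p ≤ R g)
    (hx : b ≤ Aᵀ *ᵥ x) (q : Fin K → ℝ) (t : ℝ) {η : Fin M → ℝ} (hη : 0 ≤ η) :
    x ⬝ᵥ q - ∑ g, β g t * R g ≤ arbitrageObjective sub C A b β q t η := by
  have h1 := dotProduct_sub_le_directSumCost hβ hR (q + A *ᵥ η) t
  have h2 : b ⬝ᵥ η ≤ x ⬝ᵥ (A *ᵥ η) := by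
    rw [Matrix.dotProduct_mulVec, ← Matrix.mulVec_transpose]
    exact dotProduct_le_dotProduct_of_nonneg_right hx hη
  rw [sum_block_dotProduct, dotProduct_add] at h1
  unfold arbitrageObjective
  linarith

theorem bddBelow_arbitrageObjective {x : Fin K → ℝ} {R : G → ℝ}
    (hβ : ∀ g t, 0 < β g t) (hR : ∀ g p, block sub g x ⬝ᵥ p - C g p ≤ R g)
    (hx : b ≤ Aᵀ *ᵥ x) (q : Fin K → ℝ) (t : ℝ) :
    BddBelow (arbitrageObjective sub C A b β q t '' {η | 0 ≤ η}) := by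
  refine ⟨x ⬝ᵥ q - ∑ g, β g t * R g, ?_⟩
  rintro _ ⟨η, hη, rfl⟩
  exact dotProduct_sub_le_arbitrageObjective hβ hR hx q t hη

theorem dotProduct_sub_le_lcmmCost {x : Fin K → ℝ} {R : G → ℝ}
    (hβ : ∀ g t, 0 < β g t) (hR : ∀ g p, block sub g x ⬝ᵥ p - C g p ≤ R g)
    (hx : b ≤ Aᵀ *ᵥ x) (q : Fin K → ℝ) (t : ℝ) :
    x ⬝ᵥ q - ∑ g, β g t * R g ≤ lcmmCost sub C A b β q t := by
  have : Nonempty {η : Fin M → ℝ // 0 ≤ η} := ⟨⟨0, le_rfl⟩⟩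
  exact le_ciInf fun ξ => dotProduct_sub_le_arbitrageObjective hβ hR hx q t ξ.2

/-- A nonnegative bundle along which the arbitrage objective never increases has the same payoff
`b ⬝ᵥ d` in every outcome, and this already holds within every submarket. -/
theorem block_dotProduct_eq_of_recession
    (hC : ∀ g, IsCostFunction (fun ω => block sub g (ρ ω)) (C g))
    (hρ : ∀ ω, b ≤ Aᵀ *ᵥ ρ ω) (hβ : ∀ g t, 0 < β g t) {q : Fin K → ℝ} {t : ℝ} {d : Fin M → ℝ}
    (hd : 0 ≤ d) (hrec : ∀ s : ℝ, 0 ≤ s →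
      arbitrageObjective sub C A b β q t (s • d) ≤ arbitrageObjective sub C A b β q t 0)
    (ω ω' : Ω) :
    ρ ω ⬝ᵥ (A *ᵥ d) = b ⬝ᵥ d ∧ ∀ g, block sub g (ρ ω) ⬝ᵥ block sub g (A *ᵥ d) =
      block sub g (ρ ω') ⬝ᵥ block sub g (A *ᵥ d) := by
  choose R hR using fun g ω => (hC g).exists_isLUB ω
  have hge : ∀ ω, b ⬝ᵥ d ≤ ρ ω ⬝ᵥ (A *ᵥ d) := fun ω => by
    rw [Matrix.dotProduct_mulVec, ← Matrix.mulVec_transpose]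
    exact dotProduct_le_dotProduct_of_nonneg_right (hρ ω) hd
  -- Outcomes may be chosen independently per submarket, since the direct-sum cost ignores links
  -- between submarkets. A positive excess `Δ` would make the objective grow linearly along `d`.
  have hle : ∀ σ : G → Ω, ∑ g, block sub g (ρ (σ g)) ⬝ᵥ block sub g (A *ᵥ d) ≤ b ⬝ᵥ d := by
    intro σ
    by_contra! hlt
    set Δ := ∑ g, block sub g (ρ (σ g)) ⬝ᵥ block sub g (A *ᵥ d) - b ⬝ᵥ d with hΔ
    have hΔ0 : 0 < Δ := sub_pos.2 hlt
    have hs : ∀ s : ℝ, 0 ≤ s → ∑ g, block sub g (ρ (σ g)) ⬝ᵥ block sub g q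
        - ∑ g, β g t * R g (σ g) + s * Δ ≤ arbitrageObjective sub C A b β q t 0 := by
      intro s hs
      have h1 := dotProduct_sub_le_directSumCost (C := C) hβ
        (fun g p => (hR g (σ g)).1 ⟨p, rfl⟩) (q + A *ᵥ (s • d)) t
      have h2 := hrec s hs
      simp only [arbitrageObjective, dotProduct_smul, smul_eq_mul] at h2 ⊢
      simp only [Matrix.mulVec_smul, block_add, block_smul, dotProduct_add, dotProduct_smul,
        smul_eq_mul, Finset.sum_add_distrib, ← Finset.mul_sum] at h1 h2
      rw [hΔ, mul_sub]
      linarith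
    set c := ∑ g, block sub g (ρ (σ g)) ⬝ᵥ block sub g q - ∑ g, β g t * R g (σ g)
    have h0 := hs 0 le_rfl
    -- This `s` pushes the lower bound one above the value at `0`.
    have h1 := hs ((arbitrageObjective sub C A b β q t 0 - c + 1) / Δ)
      (div_nonneg (by linarith) hΔ0.le)
    rw [div_mul_cancel₀ _ hΔ0.ne'] at h1
    linarith
  have hswap : ∀ (ω ω' : Ω) (g : G), block sub g (ρ ω') ⬝ᵥ block sub g (A *ᵥ d) ≤
      block sub g (ρ ω) ⬝ᵥ block sub g (A *ᵥ d) := by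
    intro ω ω' g
    -- Changing the outcome in `g` alone makes all other blocks cancel.
    have h1 := hle (Function.update (fun _ => ω) g ω')
    have h2 := hge ω
    rw [← sum_block_dotProduct (sub := sub)] at h2
    have h3 := h1.trans h2
    rw [← sub_nonpos, ← Finset.sum_sub_distrib, Finset.sum_eq_single g
      (fun h _ hne => by rw [Function.update_of_ne hne, sub_self])
      (fun h => absurd (Finset.mem_univ g) h), Function.update_self, sub_nonpos] at h3
    exact h3
  refine ⟨le_antisymm ?_ (hge ω), fun g => le_antisymm (hswap _ _ g) (hswap _ _ g)⟩
  rw [← sum_block_dotProduct (sub := sub)]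
  exact hle fun _ => ω

/-- Optimal arbitrage bundles exist in every state, at every time. -/
theorem exists_isOptimalArbitrage [Nonempty Ω]
    (hC : ∀ g, IsCostFunction (fun ω => block sub g (ρ ω)) (C g))
    (hρ : ∀ ω, b ≤ Aᵀ *ᵥ ρ ω) (hβ : ∀ g t, 0 < β g t) (q : Fin K → ℝ) (t : ℝ) :
    ∃ η, IsOptimalArbitrage sub C A b β q t η := by
  obtain ⟨ω₀⟩ := ‹Nonempty Ω›
  choose R hR using fun g => (hC g).exists_isLUB ω₀
  refine exists_isMinOn_nonneg (convexOn_arbitrageObjective (fun g => (hC g).convex) hβ q t)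
    (bddBelow_arbitrageObjective hβ (fun g p => (hR g).1 ⟨p, rfl⟩) (hρ ω₀) q t)
    fun d hd hrec η => ?_
  have hconst := fun ω => block_dotProduct_eq_of_recession hC hρ hβ hd
    (fun s hs => by simpa using hrec 0 s hs) ω ω₀
  have hg : ∀ g, β g t * C g ((β g t)⁻¹ • block sub g (q + A *ᵥ (η - d))) =
      β g t * C g ((β g t)⁻¹ • block sub g (q + A *ᵥ η))
        - block sub g (ρ ω₀) ⬝ᵥ block sub g (A *ᵥ d) := by
    intro g
    have hsplit : (β g t)⁻¹ • block sub g (q + A *ᵥ (η - d)) =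
        (β g t)⁻¹ • block sub g (q + A *ᵥ η) + (-(β g t)⁻¹) • block sub g (A *ᵥ d) := by
      rw [neg_smul, ← sub_eq_add_neg, ← smul_sub, Matrix.mulVec_sub, ← add_sub_assoc]
      rfl
    rw [hsplit, (hC g).apply_add (k := -(β g t)⁻¹ * (block sub g (ρ ω₀) ⬝ᵥ block sub g (A *ᵥ d)))
      (fun ω => by rw [dotProduct_smul, smul_eq_mul, (hconst ω).2 g])]
    have := (hβ g t).ne'
    field_simp
    ring
  simp only [arbitrageObjective, directSumCost, hg, Finset.sum_sub_distrib, sum_block_dotProduct,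
    dotProduct_sub, (hconst ω₀).1]
  linarith

/-! ### Loss bounds through the Fenchel gap -/

/-- The gap in Fenchel's inequality for the time-sensitive cost cannot increase in a state update
when the information-utility schedules decrease. -/
theorem fenchelGap_update_le {x : Fin K → ℝ} {R : G → ℝ}
    (hβ : ∀ g t, 0 < β g t) (hR : ∀ g p, block sub g x ⬝ᵥ p - C g p ≤ R g)
    (hx : b ≤ Aᵀ *ᵥ x) {s s' : Fin K → ℝ} {t t' : ℝ} (hβt : ∀ g, β g t' ≤ β g t)
    {η : Fin M → ℝ} (hη : IsOptimalArbitrage sub C A b β s t η)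
    (hs' : ∀ i, s' i =
      β (sub i) t' / β (sub i) t * s i + (β (sub i) t' / β (sub i) t - 1) * (A *ᵥ η) i) :
    ∑ g, β g t' * R g + lcmmCost sub C A b β s' t' - x ⬝ᵥ s' ≤
      ∑ g, β g t * R g + lcmmCost sub C A b β s t - x ⬝ᵥ s := by
  set p : (g : G) → {i : Fin K // sub i = g} → ℝ :=
    fun g => (β g t)⁻¹ • block sub g (s + A *ᵥ η) with hp
  -- The update rule says that `(s' + A η)_g = α_g (s + A η)_g`.
  have hp' : ∀ g, (β g t')⁻¹ • block sub g (s' + A *ᵥ η) = p g := by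
    intro g
    ext ⟨i, rfl⟩
    have h1 := (hβ (sub i) t).ne'
    have h2 := (hβ (sub i) t').ne'
    simp only [hp, block, Pi.smul_apply, Pi.add_apply, smul_eq_mul, hs']
    field_simp
    ring
  have hdot : ∀ (r : Fin K → ℝ) (τ : ℝ),
      (∀ g, (β g τ)⁻¹ • block sub g (r + A *ᵥ η) = p g) →
      ∑ g, β g τ * (block sub g x ⬝ᵥ p g) = x ⬝ᵥ r + x ⬝ᵥ (A *ᵥ η) := by
    intro r τ h
    rw [← dotProduct_add, ← sum_block_dotProduct (sub := sub)]
    refine Finset.sum_congr rfl fun g _ => ?_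
    rw [← h g, dotProduct_smul, smul_eq_mul, mul_inv_cancel_left₀ (hβ g τ).ne']
  have hcost : lcmmCost sub C A b β s t = ∑ g, β g t * C g (p g) - b ⬝ᵥ η := hη.lcmmCost_eq
  -- The old bundle `η` need only be feasible at the new state.
  have hcost' : lcmmCost sub C A b β s' t' ≤ ∑ g, β g t' * C g (p g) - b ⬝ᵥ η := by
    have := lcmmCost_le_arbitrageObjective
      (bddBelow_arbitrageObjective hβ hR hx s' t') hη.1
    simpa only [arbitrageObjective, directSumCost, hp'] using this
  have hsum : ∑ g, β g t' * (R g + C g (p g) - block sub g x ⬝ᵥ p g) ≤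
      ∑ g, β g t * (R g + C g (p g) - block sub g x ⬝ᵥ p g) :=
    Finset.sum_le_sum fun g _ =>
      mul_le_mul_of_nonneg_right (hβt g) (by linarith [hR g (p g)])
  simp only [mul_sub, mul_add, Finset.sum_sub_distrib, Finset.sum_add_distrib] at hsum
  rw [hdot s' t' hp', hdot s t fun _ => rfl] at hsum
  linarith

/-- The losses of the trades telescope along any potential that bounds the updates. -/
theorem gradualLoss_le {c : (Fin K → ℝ) → ℝ → ℝ} {U : (Fin K → ℝ) → ℝ → ℝ → (Fin K → ℝ)}
    {x : Fin K → ℝ} {P : ℝ → ℝ} (hU : ∀ s t t', t ≤ t' →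
      P t' + c (U s t t') t' - x ⬝ᵥ U s t t' ≤ P t + c s t - x ⬝ᵥ s)
    (s₀ : Fin K → ℝ) (r : ℕ → Fin K → ℝ) (t : ℕ → ℝ) (N : ℕ) (ht : ∀ i < N, t i ≤ t (i + 1)) :
    gradualLoss c U s₀ x N r t ≤ (P (t 0) + c s₀ (t 0) - x ⬝ᵥ s₀) -
      (P (t N) + c (stateAfter U s₀ r t N) (t N) - x ⬝ᵥ stateAfter U s₀ r t N) := by
  induction N with
  | zero => simp [gradualLoss, stateAfter]
  | succ N ih =>
    have h1 := ih fun i hi => ht i (hi.trans N.lt_succ_self)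
    have h2 := hU (stateAfter U s₀ r t N) _ _ (ht N N.lt_succ_self)
    rw [gradualLoss] at h1 ⊢
    rw [Finset.sum_range_succ]
    simp only [stateAfter, updatedState, dotProduct_add] at h1 h2 ⊢
    linarith

/-- The worst-case loss of the cost at a fixed time is at least the Fenchel gap of the initial
state. -/
theorem fenchelGap_le_wcLoss {R : G → ℝ} (hβ : ∀ g t, 0 < β g t) (ω : Ω)
    (hR : ∀ g, IsLUB (Set.range fun p => block sub g (ρ ω) ⬝ᵥ p - C g p) (R g))
    (hx : b ≤ Aᵀ *ᵥ ρ ω) (s : Fin K → ℝ) (t : ℝ) :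
    ((∑ g, β g t * R g + lcmmCost sub C A b β s t - ρ ω ⬝ᵥ s : ℝ) : EReal) ≤
      wcLoss ρ (fun q => lcmmCost sub C A b β q t) s := by
  by_contra! hlt
  obtain ⟨y, hy, hylt⟩ := EReal.lt_iff_exists_real_btwn.1 hlt
  rw [EReal.coe_lt_coe_iff] at hylt
  have hle : ∀ q, ρ ω ⬝ᵥ q - lcmmCost sub C A b β q t + lcmmCost sub C A b β s t - ρ ω ⬝ᵥ s ≤ y := by
    intro q
    have := EReal.coe_le_coe_iff.1 ((le_iSup₂ (f := fun (ω : Ω) (r : Fin K → ℝ) =>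
      ((ρ ω ⬝ᵥ r - lcmmCost sub C A b β (s + r) t + lcmmCost sub C A b β s t : ℝ) : EReal))
      ω (q - s)).trans hy.le)
    rw [add_sub_cancel, dotProduct_sub] at this
    linarith
  set Δ := ∑ g, β g t * R g + lcmmCost sub C A b β s t - ρ ω ⬝ᵥ s - y
  have hΔ : 0 < Δ := sub_pos.2 hylt
  have hB : 0 ≤ ∑ g, β g t := Finset.sum_nonneg fun g _ => (hβ g t).le
  -- The `+ 1` keeps the denominator positive even without submarkets.
  set ε := Δ / (∑ g, β g t + 1)
  have hε : 0 < ε := div_pos hΔ (by linarith)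
  have hεB : (∑ g, β g t) * ε < Δ := by
    have : (∑ g, β g t + 1) * ε = Δ := mul_div_cancel₀ _ (by linarith)
    linarith
  have hp : ∀ g, ∃ p, R g - ε < block sub g (ρ ω) ⬝ᵥ p - C g p := by
    intro g
    obtain ⟨_, ⟨p, rfl⟩, h, -⟩ := (hR g).exists_between (sub_lt_self (R g) hε)
    exact ⟨p, h⟩
  choose p hp using hp
  -- Nearly optimal submarket positions, rescaled and glued into one state; the bundle `η = 0` then
  -- bounds its cost.
  set q : Fin K → ℝ := fun i => β (sub i) t * p (sub i) ⟨i, rfl⟩ with hq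
  have hblock : ∀ g, block sub g q = β g t • p g := by
    intro g
    ext ⟨i, rfl⟩
    rfl
  have hcost : lcmmCost sub C A b β q t ≤ ∑ g, β g t * C g (p g) := by
    have := lcmmCost_le_arbitrageObjective
      (bddBelow_arbitrageObjective hβ (fun g p => (hR g).1 ⟨p, rfl⟩) hx q t) le_rfl
    simpa only [arbitrageObjective, directSumCost, Matrix.mulVec_zero, add_zero, dotProduct_zero,
      sub_zero, hblock, inv_smul_smul₀ (hβ _ t).ne'] using this
  have hdot : ρ ω ⬝ᵥ q = ∑ g, β g t * (block sub g (ρ ω) ⬝ᵥ p g) := by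
    rw [← sum_block_dotProduct (sub := sub)]
    simp only [hblock, dotProduct_smul, smul_eq_mul]
  have hsum : ∑ g, β g t * (R g - ε) ≤ ∑ g, β g t * (block sub g (ρ ω) ⬝ᵥ p g - C g (p g)) :=
    Finset.sum_le_sum fun g _ => mul_le_mul_of_nonneg_left (hp g).le (hβ g t).le
  simp only [mul_sub, Finset.sum_sub_distrib, ← Finset.sum_mul] at hsum
  have := hle q
  linarith

end LCMM

end GradualMarket

theorem mainTheorem11 {Ω G : Type*} [Finite Ω] [Nonempty Ω] [Fintype G] [DecidableEq G]
    {K M : ℕ} (ρ : Ω → Fin K → ℝ)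
    (sub : Fin K → G) (C : (g : G) → ({i : Fin K // sub i = g} → ℝ) → ℝ)
    (hC : ∀ g, GradualMarket.IsCostFunction (fun ω => GradualMarket.block sub g (ρ ω)) (C g))
    (A : Matrix (Fin K) (Fin M) ℝ) (b : Fin M → ℝ)
    (hAb : GradualMarket.priceSpace ρ = {μ | b ≤ Aᵀ *ᵥ μ})
    (β : G → ℝ → ℝ) (hβ_pos : ∀ g t, 0 < β g t)
    (hβ_diff : ∀ g, Differentiable ℝ (β g)) (hβ_anti : ∀ g, Antitone (β g)) :
    (∃ U, GradualMarket.IsNewState sub C A b β U) ∧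
    ∀ U, GradualMarket.IsNewState sub C A b β U →
      ∀ (s₀ : Fin K → ℝ) (t₀ : ℝ),
        GradualMarket.gradualWCLoss ρ (GradualMarket.lcmmCost sub C A b β) U s₀ t₀ ≤
          GradualMarket.wcLoss ρ (fun q => GradualMarket.lcmmCost sub C A b β q t₀) s₀ := by
  have hρ : ∀ ω, b ≤ Aᵀ *ᵥ ρ ω := fun ω => by
    have : ρ ω ∈ GradualMarket.priceSpace ρ := subset_convexHull ℝ _ (Set.mem_range_self ω)
    rwa [hAb] at this
  refine ⟨?_, fun U hU s₀ t₀ => ?_⟩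
  · choose η hη using GradualMarket.exists_isOptimalArbitrage hC hρ hβ_pos
    exact ⟨fun s t t' i => β (sub i) t' / β (sub i) t * s i
      + (β (sub i) t' / β (sub i) t - 1) * (A *ᵥ η s t) i,
      fun s t t' _ => ⟨η s t, hη s t, fun _ => rfl⟩⟩
  · refine iSup_le fun ω => iSup_le fun N => iSup_le fun r => iSup_le fun t => iSup_le ?_
    rintro ⟨rfl, ht⟩
    choose R hR using fun g => (hC g).exists_isLUB ω
    have hR' : ∀ g p, GradualMarket.block sub g (ρ ω) ⬝ᵥ p - C g p ≤ R g :=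
      fun g p => (hR g).1 ⟨p, rfl⟩
    refine le_trans (EReal.coe_le_coe_iff.2 ?_)
      (GradualMarket.fenchelGap_le_wcLoss hβ_pos ω hR (hρ ω) s₀ (t 0))
    have h1 := GradualMarket.gradualLoss_le (c := GradualMarket.lcmmCost sub C A b β) (U := U)
      (x := ρ ω) (P := fun t => ∑ g, β g t * R g) (fun s t t' htt' => by
        obtain ⟨η, hη, hU'⟩ := hU s t t' htt'
        exact GradualMarket.fenchelGap_update_le hβ_pos hR' (hρ ω)
          (fun g => hβ_anti g htt') hη hU') s₀ r t N ht
    -- The gap left at the final state is nonnegative and can be dropped.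
    have h2 := GradualMarket.dotProduct_sub_le_lcmmCost hβ_pos hR' (hρ ω)
      (GradualMarket.stateAfter U s₀ r t N) (t N)
    linarith
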